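/- Let $\Lambda=(\lambda_i)_{i=0}^\infty$ be a strictly increasing sequence of non-negative real numbers with $\lambda_0=0$ and $\sum_{i=1}^\infty 1/\lambda_i<\infty$, and let the Müntz space $M(\Lambda)$ be the closed linear span of the functions $t^{\lambda_i}$, $i\ge 0$, in the space $C[0,1]$ of real-valued continuous functions on $[0,1]$ with the supremum norm. Then $M(\Lambda)$ is not locally octahedral; in particular, it is not octahedral. Here a Banach space $X$ with unit sphere $S_X$ is called locally octahedral if for every $x\in S_X$ and every $\varepsilon>0$ there exists $y\in S_X$ such that $\|x+y\|>2-\varepsilon$ and $\|x-y\|>2-\varepsilon$. It is called octahedral if for every $n\ge 1$, all $x_1,\dots,x_n\in S_X$ and every $\varepsilon>0$ there exists $y\in S_X$ such that $\|x_i+y\|>2-\varepsilon$ and $\|x_i-y\|>2-\varepsilon$ for all $i\in\{1,\dots,n\}$. -/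

import Mathlib

open scoped NNReal

/-- A real Banach space is locally octahedral if for every `x` in its unit sphere and every
`ε > 0` there is `y` in the unit sphere with `‖x + y‖ > 2 - ε` and `‖x - y‖ > 2 - ε`. -/
def LocallyOctahedral (X : Type*) [NormedAddCommGroup X] : Prop :=
  ∀ x : X, ‖x‖ = 1 → ∀ ε : ℝ, 0 < ε →
    ∃ y : X, ‖y‖ = 1 ∧ ‖x + y‖ > 2 - ε ∧ ‖x - y‖ > 2 - ε

/-- A real Banach space is octahedral if for all `x₁, …, xₙ` (`n ≥ 1`) in its unit sphere and
every `ε > 0` there is a single `y` in the unit sphere with `‖xᵢ ± y‖ > 2 - ε` for all `i`. -/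
def Octahedral (X : Type*) [NormedAddCommGroup X] : Prop :=
  ∀ n : ℕ, 1 ≤ n → ∀ x : Fin n → X, (∀ i, ‖x i‖ = 1) → ∀ ε : ℝ, 0 < ε →
    ∃ y : X, ‖y‖ = 1 ∧ ∀ i, ‖x i + y‖ > 2 - ε ∧ ‖x i - y‖ > 2 - ε

/-- A Müntz sequence: `0 = λ₀ < λ₁ < λ₂ < ⋯` with `∑_{i ≥ 1} 1 / λᵢ < ∞`. -/
structure IsMuntzSequence (Λ : ℕ → ℝ≥0) : Prop where
  zero : Λ 0 = 0
  strictMono : StrictMono Λ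
  summable : Summable fun i : ℕ => 1 / (Λ (i + 1) : ℝ)

/-- The function `t ↦ t ^ a` on `[0, 1]`, for a real exponent `a ≥ 0` (it is the constant `1`
when `a = 0`). -/
noncomputable def powFun (a : ℝ≥0) : C(unitInterval, ℝ) where
  toFun t := (t : ℝ) ^ (a : ℝ)
  continuous_toFun := (Real.continuous_rpow_const a.coe_nonneg).comp continuous_subtype_val

/-- `M(Λ)`: the closed linear span of the functions `t ^ λᵢ`, `i ≥ 0`, in `C[0, 1]` with the
supremum norm. -/
noncomputable def muntzSpace (Λ : ℕ → ℝ≥0) : Submodule ℝ C(unitInterval, ℝ) :=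
  (Submodule.span ℝ (Set.range fun i : ℕ => powFun (Λ i))).topologicalClosure

/-!
Let `x` be `t ^ λ₁ - t ^ λ₂`, normalised. It is nonnegative and attains its maximum `1` only at one
point `t₀`, which lies inside `(0, 1)` (`exists_peak`). If `y` has norm one and both `x + y` and
`x - y` have norm close to `2`, then `y` is close to `1` at some point near `t₀` and close to `-1` at
another one. This is impossible once the unit ball of the Müntz space is known to be equicontinuous
at `t₀`, which is `exists_lipschitz_muntzSpace`.

For the equicontinuity, put `t = e^{-u}` and `μᵢ = λᵢ + 1/2`. A Müntz polynomial `p = ∑ᵢ cᵢ t ^ λᵢ`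
becomes `e^{u/2} f` with `f = ∑ᵢ cᵢ e^{-μᵢ u}`, and the squared `L²(0, ∞)` norm
`∑ᵢⱼ cᵢ cⱼ / (μᵢ + μⱼ)` of `f` is at most `‖p‖²`. The coefficients themselves are not bounded in terms
of `‖p‖`, since the exponents may have arbitrarily small gaps. What is bounded is the transform
`F(w) = ∑ᵢ cᵢ / (μᵢ - w)` for `w` in the right half-plane and off the real axis: by
`norm_sq_cauchy_transform_le`,
`|F(w)|² ≤ ‖f‖² (∏ᵢ |μᵢ + w|² / |μᵢ - w|² - 1) / (2 Re w)`.
On the boundary rays of the sector `|arg w| < π / 4` the product is `e^{o(|w|)}`, because `∑ᵢ 1 / μᵢ`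
converges (`exists_prod_ray_le`). Cauchy's formula recovers `f(u)` as a multiple of the imaginary part
of `∫ e^{-u w} F(w) dw` over one of these rays (`exists_exp_eq_integral`), and the factor `e^{-u w}`
beats the growth of `F`, so that `f` is Lipschitz on every `[s, ∞)` with a constant independent of the
polynomial (`exists_lipschitz_expSum`). The bound passes to the closed span.
-/

open MeasureTheory Set

/-! ### The Gram form of exponentials and the Cauchy transform -/

/-- The quadratic form `∑ᵢⱼ cᵢ cⱼ / (μᵢ + μⱼ)` over a finite set of indices. For positive exponents
`μᵢ` it is the squared norm of `∑ᵢ cᵢ e^{-μᵢ u}` in `L²(0, ∞)`. -/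
noncomputable def gramForm {ι : Type*} (S : Finset ι) (μ c : ι → ℝ) : ℝ :=
  ∑ i ∈ S, ∑ j ∈ S, c i * c j / (μ i + μ j)

/-- Applying the Blaschke multiplier `(a - μᵢ) / (a + μᵢ)` to the coefficients does not increase the
Gram form; the loss is the square of a single linear functional. This is the contractivity of a
Blaschke factor on `L²`, in algebraic form. -/
lemma gramForm_eq_add {ι : Type*} (S : Finset ι) (μ c : ι → ℝ) (hμ : ∀ i, 0 < μ i) {a : ℝ}
    (ha : 0 < a) :
    gramForm S μ c = gramForm S μ (fun i => (a - μ i) / (a + μ i) * c i)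
      + 2 * a * (∑ i ∈ S, c i / (a + μ i)) ^ 2 := by
  unfold gramForm
  rw [sq, Finset.sum_mul_sum, Finset.mul_sum, ← Finset.sum_add_distrib]
  refine Finset.sum_congr rfl fun i _ => ?_
  rw [Finset.mul_sum, ← Finset.sum_add_distrib]
  refine Finset.sum_congr rfl fun j _ => ?_
  have := hμ i
  have := hμ j
  field_simp
  ring

lemma gramForm_insert_of_eq_zero {ι : Type*} [DecidableEq ι] {S : Finset ι} {k : ι} (hk : k ∉ S)
    (μ d : ι → ℝ) (hd : d k = 0) : gramForm (insert k S) μ d = gramForm S μ d := by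
  simp [gramForm, Finset.sum_insert hk, hd]

lemma gramForm_nonneg {ι : Type*} (S : Finset ι) (μ c : ι → ℝ) (hμ : ∀ i, 0 < μ i) :
    0 ≤ gramForm S μ c := by
  classical
  induction S using Finset.induction_on generalizing c with
  | empty => simp [gramForm]
  | insert k S hk ih =>
    have hk0 := hμ k
    rw [gramForm_eq_add _ μ c hμ hk0, gramForm_insert_of_eq_zero hk _ _ (by simp)]
    have := ih fun i => (μ k - μ i) / (μ k + μ i) * c i
    positivity

lemma sub_ofReal_ne_zero {x : ℝ} {w : ℂ} (hw : w.im ≠ 0) : (x : ℂ) - w ≠ 0 := by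
  intro h
  apply hw
  simpa using congrArg Complex.im h

/-- The identity, for the transform `∑ᵢ cᵢ / (μᵢ - w)`, matching `gramForm_eq_add`: it splits off the
same linear functional and divides the rest by the Blaschke factor at `w`. -/
lemma cauchy_transform_decomp {ι : Type*} (S : Finset ι) (μ c : ι → ℝ) (hμ : ∀ i, 0 < μ i) {a : ℝ}
    (ha : 0 < a) {w : ℂ} (hw : w.im ≠ 0) :
    ∑ i ∈ S, (c i : ℂ) / (μ i - w)
      = ((2 * a * ∑ i ∈ S, c i / (a + μ i) : ℝ) : ℂ) / (a - w)
        + (a + w) / (a - w) * ∑ i ∈ S, (((a - μ i) / (a + μ i) * c i : ℝ) : ℂ) / (μ i - w) := by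
  push_cast
  rw [Finset.mul_sum, Finset.mul_sum, Finset.sum_div, ← Finset.sum_add_distrib]
  refine Finset.sum_congr rfl fun i _ => ?_
  have h1 : (a : ℂ) - w ≠ 0 := sub_ofReal_ne_zero hw
  have h2 : (μ i : ℂ) - w ≠ 0 := sub_ofReal_ne_zero hw
  have h3 : (a : ℂ) + μ i ≠ 0 := by
    exact_mod_cast (add_pos ha (hμ i)).ne'
  field_simp
  ring

lemma sq_norm_add_eq_sq_norm_sub_add (a : ℝ) (w : ℂ) :
    ‖(a : ℂ) + w‖ ^ 2 = ‖(a : ℂ) - w‖ ^ 2 + 4 * a * w.re := by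
  simp only [← Complex.normSq_eq_norm_sq, Complex.normSq_apply]
  simp
  ring

/-- The Cauchy transform of the coefficients is controlled off the real axis by the Gram form, with
a constant that involves the exponents only through a Blaschke product, so that the gaps between
the exponents play no role. The constant is the reproducing kernel of the span of the exponentials:
the exponents are removed one at a time, and Cauchy-Schwarz is applied at each removal. -/
lemma norm_sq_cauchy_transform_le {ι : Type*} (S : Finset ι) (μ : ι → ℝ) (hμ : ∀ i, 0 < μ i)
    {w : ℂ} (hw : w.im ≠ 0) (hre : 0 < w.re) (c : ι → ℝ) :
    ‖∑ i ∈ S, (c i : ℂ) / (μ i - w)‖ ^ 2 ≤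
      gramForm S μ c * ((∏ i ∈ S, ‖(μ i : ℂ) + w‖ ^ 2 / ‖(μ i : ℂ) - w‖ ^ 2 - 1) / (2 * w.re)) := by
  classical
  suffices H : ∀ c : ι → ℝ, 1 ≤ ∏ i ∈ S, ‖(μ i : ℂ) + w‖ ^ 2 / ‖(μ i : ℂ) - w‖ ^ 2 ∧
      ‖∑ i ∈ S, (c i : ℂ) / (μ i - w)‖ ^ 2 ≤ gramForm S μ c *
        ((∏ i ∈ S, ‖(μ i : ℂ) + w‖ ^ 2 / ‖(μ i : ℂ) - w‖ ^ 2 - 1) / (2 * w.re)) from (H c).2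
  induction S using Finset.induction_on with
  | empty => intro c; simp [gramForm]
  | insert k S hk ih =>
    intro c
    set a := μ k with ha_def
    have ha : 0 < a := hμ k
    set d : ι → ℝ := fun i => (a - μ i) / (a + μ i) * c i with hd
    have hdk : d k = 0 := by simp [hd, ha_def]
    obtain ⟨hP, hb⟩ := ih d
    have hQ : 0 ≤ gramForm S μ d := gramForm_nonneg S μ d hμ
    rw [gramForm_eq_add _ μ c hμ ha, gramForm_insert_of_eq_zero hk μ d hdk,
      cauchy_transform_decomp _ μ c hμ ha hw, Finset.prod_insert hk]
    set β := ∑ i ∈ insert k S, c i / (a + μ i)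
    have hsum : ∑ i ∈ insert k S, (((a - μ i) / (a + μ i) * c i : ℝ) : ℂ) / (μ i - w)
        = ∑ i ∈ S, (d i : ℂ) / (μ i - w) := by
      rw [Finset.sum_insert hk]
      simp [hd, ha_def]
    rw [hsum]
    set P := ∏ i ∈ S, ‖(μ i : ℂ) + w‖ ^ 2 / ‖(μ i : ℂ) - w‖ ^ 2
    set D := ∑ i ∈ S, (d i : ℂ) / (μ i - w)
    set q := gramForm S μ d
    have hm : 0 < ‖(a : ℂ) - w‖ := norm_pos_iff.2 (sub_ofReal_ne_zero hw)
    have hratio : 1 ≤ ‖(a : ℂ) + w‖ ^ 2 / ‖(a : ℂ) - w‖ ^ 2 := by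
      rw [one_le_div (by positivity), sq_norm_add_eq_sq_norm_sub_add]
      nlinarith [mul_pos ha hre]
    refine ⟨one_le_mul_of_one_le_of_one_le hratio hP, ?_⟩
    set M := ‖(a : ℂ) - w‖
    set R := ‖(a : ℂ) + w‖
    have hR : R ^ 2 = M ^ 2 + 4 * a * w.re := sq_norm_add_eq_sq_norm_sub_add a w
    have htri : ‖((2 * a * β : ℝ) : ℂ) / (a - w) + (a + w) / (a - w) * D‖ ≤
        (2 * a * |β| + R * ‖D‖) / M := by
      refine (norm_add_le _ _).trans (le_of_eq ?_)
      rw [norm_mul, norm_div, norm_div, Complex.norm_real, Real.norm_eq_abs, abs_mul,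
        abs_of_pos (by positivity : 0 < 2 * a)]
      change 2 * a * |β| / M + R / M * ‖D‖ = _
      ring
    set X := (P - 1) / (2 * w.re)
    have hX : 0 ≤ X := div_nonneg (by linarith) (by positivity)
    -- Cauchy-Schwarz for the pairing of `(√(2a) |β|, √q)` with `(√(2a), R √X)`
    have hcs : (2 * a * |β| + R * ‖D‖) ^ 2 ≤ (q + 2 * a * β ^ 2) * (2 * a + R ^ 2 * X) := by
      have h1 : ‖D‖ ≤ √q * √X := by
        rw [← Real.sqrt_mul hQ]
        exact Real.le_sqrt_of_sq_le hb
      have hR0 : 0 ≤ R := norm_nonneg _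
      have h2 : (2 * a * |β| + R * ‖D‖) ^ 2 ≤ (2 * a * |β| + R * (√q * √X)) ^ 2 := by gcongr
      refine h2.trans ?_
      have e1 : √q ^ 2 = q := Real.sq_sqrt hQ
      have e2 : √X ^ 2 = X := Real.sq_sqrt hX
      have e3 : |β| ^ 2 = β ^ 2 := sq_abs β
      rw [← e3]
      nth_rewrite 2 [← e1]
      nth_rewrite 2 [← e2]
      nlinarith [mul_nonneg ha.le (sq_nonneg (√q - |β| * R * √X))]
    calc _ ≤ ((2 * a * |β| + R * ‖D‖) / M) ^ 2 := by gcongr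
      _ = (2 * a * |β| + R * ‖D‖) ^ 2 / M ^ 2 := by rw [div_pow]
      _ ≤ (q + 2 * a * β ^ 2) * (2 * a + R ^ 2 * X) / M ^ 2 := by gcongr
      _ = _ := by
        rw [mul_div_assoc]
        congr 1
        simp only [X]
        rw [hR]
        field_simp
        ring

/-- With `t = e^{-u}`, the Gram form of the exponents `λᵢ + 1/2` is the integral over `[0, 1]` of the
square of `∑ᵢ cᵢ t ^ λᵢ`. -/
lemma gramForm_le_sq_norm (S : Finset ℕ) (Λ : ℕ → ℝ≥0) (c : ℕ → ℝ) :
    gramForm S (fun i => (Λ i : ℝ) + 1 / 2) c ≤ ‖∑ i ∈ S, c i • powFun (Λ i)‖ ^ 2 := by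
  set p := ∑ i ∈ S, c i • powFun (Λ i) with hp
  have hint : gramForm S (fun i => (Λ i : ℝ) + 1 / 2) c
      = ∫ t in (0 : ℝ)..1, (∑ i ∈ S, c i * t ^ (Λ i : ℝ)) ^ 2 := by
    have hI : ∀ i j, IntervalIntegrable
        (fun t : ℝ => c i * t ^ (Λ i : ℝ) * (c j * t ^ (Λ j : ℝ))) volume 0 1 := fun i j =>
      (((Real.continuous_rpow_const (Λ i).coe_nonneg).const_mul _ |>.mul
        ((Real.continuous_rpow_const (Λ j).coe_nonneg).const_mul _))).intervalIntegrable _ _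
    simp_rw [sq, Finset.sum_mul_sum]
    rw [intervalIntegral.integral_finsetSum
      (fun i _ => by simpa only [Finset.sum_fn] using IntervalIntegrable.sum S fun j _ => hI i j)]
    refine Finset.sum_congr rfl fun i _ => ?_
    rw [intervalIntegral.integral_finsetSum (fun j _ => hI i j)]
    refine Finset.sum_congr rfl fun j _ => ?_
    have : ∀ t ∈ Set.uIoc (0 : ℝ) 1, c i * t ^ (Λ i : ℝ) * (c j * t ^ (Λ j : ℝ))
        = c i * c j * t ^ ((Λ i : ℝ) + Λ j) := by
      intro t ht
      rw [Set.uIoc_of_le zero_le_one] at ht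
      rw [Real.rpow_add ht.1]
      ring
    rw [intervalIntegral.integral_congr_ae (ae_of_all _ this), intervalIntegral.integral_const_mul,
      integral_rpow (Or.inl (by have := (Λ i).coe_nonneg; have := (Λ j).coe_nonneg; linarith))]
    have h0 : (Λ i : ℝ) + Λ j + 1 ≠ 0 := by positivity
    rw [Real.one_rpow, Real.zero_rpow h0]
    ring_nf
  rw [hint]
  have hb : ∀ t ∈ Set.uIoc (0 : ℝ) 1, ‖(∑ i ∈ S, c i * t ^ (Λ i : ℝ)) ^ 2‖ ≤ ‖p‖ ^ 2 := by
    intro t ht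
    rw [Set.uIoc_of_le zero_le_one] at ht
    have h := p.norm_coe_le_norm ⟨t, ht.1.le, ht.2⟩
    have he : p ⟨t, ht.1.le, ht.2⟩ = ∑ i ∈ S, c i * t ^ (Λ i : ℝ) := by
      simp [hp, ContinuousMap.sum_apply, powFun]
    rw [he] at h
    rw [norm_pow]
    gcongr
  have := intervalIntegral.norm_integral_le_of_norm_le_const hb
  simp only [sub_zero, abs_one, mul_one] at this
  exact (le_abs_self _).trans this

/-! ### Cauchy's formula for the exponential on a sector -/

/-- The integrand, at the point `w = r (1 + i)` of a ray, of the contour integral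
`∫ e^{-x (w - 1)} / (w - 1) dw`. -/
noncomputable def rayKernel (x r : ℝ) : ℂ :=
  (1 + Complex.I) * Complex.exp (-(x * (r * (1 + Complex.I) - 1))) / (r * (1 + Complex.I) - 1)

lemma norm_one_add_I_le : ‖(1 + Complex.I : ℂ)‖ ≤ 2 :=
  (norm_add_le _ _).trans (by simp; norm_num)

lemma quarter_le_norm_ray_sub_one (r : ℝ) :
    (1 + r) / 4 ≤ ‖(r * (1 + Complex.I) - 1 : ℂ)‖ := by
  refine le_of_sq_le_sq ?_ (norm_nonneg _)
  rw [← Complex.normSq_eq_norm_sq, Complex.normSq_apply]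
  simp
  nlinarith [sq_nonneg (r - 1 / 2)]

lemma ray_sub_one_ne_zero (r : ℝ) : (r * (1 + Complex.I) - 1 : ℂ) ≠ 0 := by
  intro h
  have h1 := congrArg Complex.re h
  have h2 := congrArg Complex.im h
  simp at h1 h2
  simp [h2] at h1

lemma norm_exp_ray (x r : ℝ) :
    ‖Complex.exp (-(x * (r * (1 + Complex.I) - 1)))‖ = Real.exp (x - x * r) := by
  rw [Complex.norm_exp]
  congr 1
  simp
  ring

lemma continuous_rayKernel : Continuous fun p : ℝ × ℝ => rayKernel p.1 p.2 := by
  unfold rayKernel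
  refine Continuous.div (by fun_prop) (by fun_prop) fun p => ray_sub_one_ne_zero p.2

lemma norm_rayKernel_le (x : ℝ) {r : ℝ} (hr : 0 ≤ r) :
    ‖rayKernel x r‖ ≤ 8 / (1 + r) * Real.exp (x - x * r) := by
  rw [rayKernel, norm_div, norm_mul, norm_exp_ray]
  calc _ ≤ 2 * Real.exp (x - x * r) / ((1 + r) / 4) := by
        gcongr
        · exact norm_one_add_I_le
        · exact quarter_le_norm_ray_sub_one r
    _ = _ := by field_simp; norm_num

lemma integrableOn_exp_sub_mul {x : ℝ} (hx : 0 < x) (y : ℝ) :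
    IntegrableOn (fun r : ℝ => Real.exp (y - x * r)) (Ioi 0) := by
  have := (exp_neg_integrableOn_Ioi 0 hx).const_mul (Real.exp y)
  refine this.congr (ae_of_all _ fun r => ?_)
  simp only
  rw [← Real.exp_add]
  congr 1
  ring

lemma integrableOn_rayKernel {x : ℝ} (hx : 0 < x) :
    IntegrableOn (rayKernel x) (Ioi 0) := by
  refine Integrable.mono' ((integrableOn_exp_sub_mul hx x).const_mul 8)
    (continuous_rayKernel.comp (Continuous.prodMk_right x)).aestronglyMeasurable ?_
  refine (ae_restrict_iff' measurableSet_Ioi).2 (ae_of_all _ fun r hr => ?_)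
  refine (norm_rayKernel_le x (le_of_lt hr)).trans ?_
  gcongr
  exact div_le_self (by norm_num) (by linarith [show (0 : ℝ) < r from hr])

/-- Differentiating in `x` cancels the denominator, and what is left is an elementary integral with
a real value. -/
lemma hasDerivAt_integral_rayKernel {x : ℝ} (hx : 0 < x) :
    HasDerivAt (fun x => ∫ r in Ioi 0, rayKernel x r) (-(Real.exp x / x : ℝ) : ℂ) x := by
  have key := (hasDerivAt_integral_of_dominated_loc_of_deriv_le
    (μ := volume.restrict (Ioi (0 : ℝ))) (F := rayKernel) (x₀ := x)
    (s := Ioo (x / 2) (2 * x)) (Ioo_mem_nhds (by linarith) (by linarith))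
    (Filter.Eventually.of_forall fun y =>
      (continuous_rayKernel.comp (Continuous.prodMk_right y)).aestronglyMeasurable)
    (integrableOn_rayKernel hx)
    (F' := fun x r => -((1 + Complex.I) * Complex.exp (-(x * (r * (1 + Complex.I) - 1)))))
    (by fun_prop) (bound := fun r => 2 * Real.exp (2 * x - x / 2 * r)) ?_
    ((integrableOn_exp_sub_mul (by linarith) _).const_mul 2) ?_).2
  · refine key.congr_deriv ?_
    have h1 : ∀ r : ℝ, -((1 + Complex.I) * Complex.exp (-(x * (r * (1 + Complex.I) - 1))))
        = -((1 + Complex.I) * Complex.exp x) * Complex.exp ((-x * (1 + Complex.I)) * r) := by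
      intro r
      rw [neg_mul, mul_assoc, ← Complex.exp_add]
      congr 3
      ring
    have hI : (1 + Complex.I : ℂ) ≠ 0 := fun h => by simpa using congrArg Complex.im h
    have hxc : (x : ℂ) ≠ 0 := by exact_mod_cast hx.ne'
    refine (integral_congr_ae (ae_of_all _ h1)).trans ?_
    rw [integral_const_mul, integral_exp_mul_complex_Ioi (by simpa using hx)]
    push_cast
    simp only [mul_zero, Complex.exp_zero]
    field_simp
  · refine (ae_restrict_iff' measurableSet_Ioi).2 (ae_of_all _ fun r hr y hy => ?_)
    rw [norm_neg, norm_mul, norm_exp_ray]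
    have hr' : (0 : ℝ) < r := hr
    gcongr
    · exact norm_one_add_I_le
    · exact hy.2.le
    · exact hy.1.le
  · refine ae_of_all _ fun r y _ => ?_
    have hne := ray_sub_one_ne_zero r
    have h : HasDerivAt (fun y : ℝ => -((y : ℂ) * (r * (1 + Complex.I) - 1)))
        (-(1 * (r * (1 + Complex.I) - 1))) y :=
      ((Complex.ofRealCLM.hasDerivAt (x := y)).mul_const _).neg
    refine ((h.cexp.const_mul (1 + Complex.I)).div_const _).congr_deriv ?_
    rw [div_eq_iff hne]
    ring

/-- By Fubini the integral is that of the imaginary part of `(1 + i) / (w ^ 2 - 1)` along the ray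
`w = r (1 + i)`, which is negative everywhere. -/
lemma integral_exp_mul_rayKernel_im_neg :
    ∫ x in Ioi (0 : ℝ), Real.exp (-(2 * x)) * (∫ r in Ioi (0 : ℝ), rayKernel x r).im < 0 := by
  set f : ℝ → ℝ → ℝ := fun x r => Real.exp (-(2 * x)) * (rayKernel x r).im with hf
  have hcont : Continuous (Function.uncurry f) := by
    have h : Continuous fun p : ℝ × ℝ => Real.exp (-(2 * p.1)) * (rayKernel p.1 p.2).im :=
      Continuous.mul (by fun_prop) (Complex.continuous_im.comp continuous_rayKernel)
    exact h
  have hle : ∀ x : ℝ, ∀ r : ℝ, 0 < r → ‖f x r‖ ≤ 8 / (1 + r) * Real.exp (0 - (1 + r) * x) := by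
    intro x r hr
    rw [hf, norm_mul, Real.norm_of_nonneg (Real.exp_pos _).le, Real.norm_eq_abs]
    calc _ ≤ Real.exp (-(2 * x)) * (8 / (1 + r) * Real.exp (x - x * r)) := by
          gcongr
          exact (Complex.abs_im_le_norm _).trans (norm_rayKernel_le x hr.le)
      _ = 8 / (1 + r) * (Real.exp (-(2 * x)) * Real.exp (x - x * r)) := by ring
      _ = _ := by
          rw [← Real.exp_add]
          congr 2
          ring
  have hx_int : ∀ r : ℝ, 0 < r → IntegrableOn (fun x => f x r) (Ioi 0) := by
    intro r hr
    refine Integrable.mono' ((integrableOn_exp_sub_mul (show 0 < 1 + r by linarith) 0).const_mul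
      (8 / (1 + r))) (hcont.comp (Continuous.prodMk_left r)).aestronglyMeasurable
      (ae_of_all _ fun x => hle x r hr)
  have hexp : ∀ r : ℝ, 0 < r →
      ∫ x in Ioi (0 : ℝ), Real.exp (0 - (1 + r) * x) = 1 / (1 + r) := by
    intro r hr
    have := integral_exp_mul_Ioi (show -(1 + r) < 0 by linarith) 0
    simp only [neg_mul, mul_zero, Real.exp_zero] at this
    simp only [zero_sub]
    rw [this]
    rw [neg_div_neg_eq]
  have hprod : Integrable (Function.uncurry f)
      ((volume.restrict (Ioi 0)).prod (volume.restrict (Ioi 0))) := by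
    rw [integrable_prod_iff' hcont.aestronglyMeasurable]
    refine ⟨(ae_restrict_iff' measurableSet_Ioi).2 (ae_of_all _ fun r hr => hx_int r hr), ?_⟩
    refine Integrable.mono' ((integrable_inv_one_add_sq.const_mul 8).integrableOn)
      hcont.norm.aestronglyMeasurable.prod_swap.integral_prod_right' ?_
    refine (ae_restrict_iff' measurableSet_Ioi).2 (ae_of_all _ fun r hr => ?_)
    have hr' : (0 : ℝ) < r := hr
    rw [Real.norm_of_nonneg (integral_nonneg fun _ => norm_nonneg _)]
    calc _ ≤ ∫ x in Ioi (0 : ℝ), 8 / (1 + r) * Real.exp (0 - (1 + r) * x) :=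
          integral_mono (hx_int r hr).norm
            ((integrableOn_exp_sub_mul (show 0 < 1 + r by linarith) 0).const_mul _)
            fun x => hle x r hr
      _ = 8 / (1 + r) * (1 / (1 + r)) := by rw [integral_const_mul, hexp r hr]
      _ = 8 * ((1 + r) ^ 2)⁻¹ := by field_simp
      _ ≤ 8 * (1 + r ^ 2)⁻¹ := by
          gcongr
          nlinarith
  have h1 : ∫ x in Ioi (0 : ℝ), Real.exp (-(2 * x)) * (∫ r in Ioi (0 : ℝ), rayKernel x r).im
      = ∫ x in Ioi (0 : ℝ), ∫ r in Ioi (0 : ℝ), f x r := by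
    refine setIntegral_congr_fun measurableSet_Ioi fun x hx => ?_
    simp only [hf]
    rw [integral_const_mul]
    congr 1
    exact (integral_im (integrableOn_rayKernel hx)).symm
  rw [h1, integral_integral_swap hprod]
  have h2 : ∀ r ∈ Ioi (0 : ℝ), ∫ x in Ioi (0 : ℝ), f x r = -((2 * r ^ 2 + 1) / (4 * r ^ 4 + 1)) := by
    intro r hr
    have hr' : (0 : ℝ) < r := hr
    have hne := ray_sub_one_ne_zero r
    have hne2 : (r * (1 + Complex.I) + 1 : ℂ) ≠ 0 := fun h => by
      have h1 := congrArg Complex.im h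
      simp at h1
      linarith
    set A : ℂ := (1 + Complex.I) / (r * (1 + Complex.I) - 1) with hA
    set b : ℂ := -(r * (1 + Complex.I) + 1) with hb
    have hbre : b.re < 0 := by simp [hb]; linarith
    have e1 : ∀ x : ℝ, f x r = RCLike.im (A * Complex.exp (b * x)) := by
      intro x
      have : A * Complex.exp (b * x) = (Real.exp (-(2 * x)) : ℂ) * rayKernel x r := by
        rw [rayKernel, hA, hb, Complex.ofReal_exp]
        rw [show (-(r * (1 + Complex.I) + 1) : ℂ) * x
          = ((-(2 * x) : ℝ) : ℂ) + -(x * (r * (1 + Complex.I) - 1)) by push_cast; ring,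
          Complex.exp_add]
        ring
      rw [this]
      exact (Complex.im_ofReal_mul _ _).symm
    simp_rw [e1]
    rw [integral_im ((integrableOn_exp_mul_complex_Ioi hbre 0).const_mul A), integral_const_mul,
      integral_exp_mul_complex_Ioi hbre]
    have e2 : A * (-Complex.exp (b * (0 : ℝ)) / b)
        = ((2 * r ^ 2 - 1 : ℝ) + (-(2 * r ^ 2 + 1) : ℝ) * Complex.I) / ((4 * r ^ 4 + 1 : ℝ) : ℂ) := by
      have h4 : ((4 * r ^ 4 + 1 : ℝ) : ℂ) ≠ 0 := by
        have : (0 : ℝ) < 4 * r ^ 4 + 1 := by positivity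
        exact_mod_cast this.ne'
      rw [hA, hb, eq_div_iff h4]
      push_cast
      simp only [mul_zero, Complex.exp_zero, neg_div_neg_eq]
      rw [div_mul_div_comm, div_mul_eq_mul_div, div_eq_iff (mul_ne_zero hne hne2)]
      ring_nf
      simp only [Complex.I_sq, Complex.I_pow_three]
      ring
    rw [e2]
    change Complex.im _ = _
    rw [Complex.div_ofReal_im, Complex.add_im, Complex.ofReal_im, Complex.im_ofReal_mul,
      Complex.I_im]
    ring
  rw [setIntegral_congr_fun measurableSet_Ioi h2, integral_neg, neg_lt_zero]
  have hint : IntegrableOn (fun r : ℝ => (2 * r ^ 2 + 1) / (4 * r ^ 4 + 1)) (Ioi 0) := by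
    refine Integrable.mono' ((integrable_inv_one_add_sq.const_mul 3).integrableOn)
      (Continuous.aestronglyMeasurable (Continuous.div (by fun_prop) (by fun_prop)
        fun r => by positivity)) (ae_of_all _ fun r => ?_)
    rw [Real.norm_of_nonneg (by positivity), ← div_eq_mul_inv,
      div_le_div_iff₀ (by positivity) (by positivity)]
    nlinarith [sq_nonneg (r ^ 2 - 1), sq_nonneg (r ^ 2), sq_nonneg (10 * r ^ 2 - 3)]
  rw [setIntegral_pos_iff_support_of_nonneg_ae (ae_of_all _ fun r => by positivity) hint]
  have : Function.support (fun r : ℝ => (2 * r ^ 2 + 1) / (4 * r ^ 4 + 1)) = univ := by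
    ext r
    simp only [Function.mem_support, mem_univ, iff_true]
    positivity
  rw [this, univ_inter]
  simp

/-- The imaginary part has zero derivative, hence is constant; it does not vanish since its integral
against `e^{-2x}` does not. -/
lemma exists_integral_rayKernel_im :
    ∃ κ : ℝ, κ ≠ 0 ∧ ∀ x : ℝ, 0 < x → (∫ r in Ioi (0 : ℝ), rayKernel x r).im = κ := by
  set g : ℝ → ℝ := fun x => (∫ r in Ioi (0 : ℝ), rayKernel x r).im with hg
  have hd : ∀ x : ℝ, 0 < x → HasDerivAt g 0 x := by
    intro x hx
    have := Complex.imCLM.hasFDerivAt.comp_hasDerivAt x (hasDerivAt_integral_rayKernel hx)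
    refine this.congr_deriv ?_
    rw [Complex.imCLM_apply, ← Complex.ofReal_neg, Complex.ofReal_im]
  have hconst : ∀ x : ℝ, 0 < x → g x = g 1 := by
    intro x hx
    exact isOpen_Ioi.is_const_of_deriv_eq_zero isPreconnected_Ioi
      (fun y hy => (hd y hy).differentiableAt.differentiableWithinAt)
      (fun y hy => (hd y hy).deriv) hx (by simp)
  refine ⟨g 1, fun h0 => ?_, hconst⟩
  refine integral_exp_mul_rayKernel_im_neg.ne ?_
  refine (setIntegral_congr_fun (g := fun _ => (0 : ℝ)) measurableSet_Ioi fun x hx => ?_).trans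
    (by simp)
  have := hconst x hx
  rw [h0] at this
  simp only [hg] at this
  simp [this]

/-- Cauchy's formula for `e^{-l s}` on the boundary of the sector `|arg w| < π / 4`: the two boundary
rays are conjugate, so that only the imaginary part of the integral over one of them is needed. The
value of the constant is irrelevant. -/
lemma exists_exp_eq_integral :
    ∃ κ : ℝ, κ ≠ 0 ∧ ∀ l s : ℝ, 0 < l → 0 < s →
      IntegrableOn (fun r : ℝ => (1 + Complex.I) * Complex.exp (-(s * (r * (1 + Complex.I))))
        / (l - r * (1 + Complex.I))) (Ioi 0) ∧
      (∫ r in Ioi (0 : ℝ), (1 + Complex.I) * Complex.exp (-(s * (r * (1 + Complex.I))))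
        / (l - r * (1 + Complex.I))).im = κ * Real.exp (-(l * s)) := by
  obtain ⟨κ, hκ, h⟩ := exists_integral_rayKernel_im
  refine ⟨-κ, neg_ne_zero.2 hκ, fun l s hl hs => ?_⟩
  have hlc : (l : ℂ) ≠ 0 := by exact_mod_cast hl.ne'
  have key : ∀ r : ℝ, (1 + Complex.I) * Complex.exp (-(s * (r * (1 + Complex.I))))
      / (l - r * (1 + Complex.I))
      = ((-(Real.exp (-(l * s)) * l⁻¹) : ℝ) : ℂ) * rayKernel (l * s) (l⁻¹ * r) := by
    intro r
    have h1 := ray_sub_one_ne_zero (l⁻¹ * r)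
    have h2 : (l : ℂ) - r * (1 + Complex.I) = -l * (((l⁻¹ * r : ℝ) : ℂ) * (1 + Complex.I) - 1) := by
      push_cast
      field_simp
      ring
    rw [rayKernel, h2]
    rw [show (-(s * (r * (1 + Complex.I))) : ℂ) = ((-(l * s) : ℝ) : ℂ)
      + -(((l * s : ℝ) : ℂ) * (((l⁻¹ * r : ℝ) : ℂ) * (1 + Complex.I) - 1)) by
        push_cast; field_simp; ring, Complex.exp_add, ← Complex.ofReal_exp]
    rw [Complex.ofReal_neg (_ * _), Complex.ofReal_mul (Real.exp _), Complex.ofReal_inv]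
    field_simp
  have hint := integrableOn_rayKernel (mul_pos hl hs)
  simp_rw [key]
  constructor
  · have := (integrableOn_Ioi_comp_mul_left_iff (rayKernel (l * s)) 0 (inv_pos.2 hl)).2
      (by simpa using hint)
    exact this.const_mul _
  · rw [integral_const_mul, integral_comp_mul_left_Ioi _ _ (inv_pos.2 hl), Complex.im_ofReal_mul,
      mul_zero, Complex.smul_im, h _ (mul_pos hl hs)]
    simp
    field_simp

/-! ### Equicontinuity of the unit ball of a Müntz space -/

lemma norm_ray_add_sq_div_le {m r : ℝ} (hm : 0 < m) (hr : 0 < r) :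
    ‖(m : ℂ) + r * (1 + Complex.I)‖ ^ 2 / ‖(m : ℂ) - r * (1 + Complex.I)‖ ^ 2
      ≤ min 6 (Real.exp (8 * r * (1 / m))) := by
  have h1 : ‖(m : ℂ) + r * (1 + Complex.I)‖ ^ 2 = m ^ 2 + 2 * m * r + 2 * r ^ 2 := by
    rw [← Complex.normSq_eq_norm_sq, Complex.normSq_apply]
    simp
    ring
  have h2 : ‖(m : ℂ) - r * (1 + Complex.I)‖ ^ 2 = m ^ 2 - 2 * m * r + 2 * r ^ 2 := by
    rw [← Complex.normSq_eq_norm_sq, Complex.normSq_apply]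
    simp
    ring
  have h3 : 0 < m ^ 2 - 2 * m * r + 2 * r ^ 2 := by nlinarith [sq_nonneg (m - r)]
  rw [h1, h2]
  refine le_min ?_ ?_
  · rw [div_le_iff₀ h3]
    nlinarith [sq_nonneg (m - 7 / 5 * r), mul_pos hm hr]
  · refine le_trans ?_ (Real.add_one_le_exp _)
    rw [div_le_iff₀ h3]
    have : (8 * r * (1 / m) + 1) * (m ^ 2 - 2 * m * r + 2 * r ^ 2)
      = m ^ 2 + 2 * m * r + 2 * r ^ 2 + 4 * r / m * (m - 2 * r) ^ 2 := by
      field_simp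
      ring
    rw [this]
    have : 0 ≤ 4 * r / m * (m - 2 * r) ^ 2 := by positivity
    linarith

/-- On the ray `r (1 + i)` the Blaschke product grows more slowly than every exponential, uniformly in
the finite set of exponents. Finitely many factors are bounded by `6`, and the others contribute at
most `e^{8 r ∑ 1 / μᵢ}` with a small sum. -/
lemma exists_prod_ray_le (μ : ℕ → ℝ) (hμ : ∀ i, 0 < μ i) (hsum : Summable fun i => 1 / μ i)
    {δ : ℝ} (hδ : 0 < δ) :
    ∃ C : ℝ, 0 < C ∧ ∀ (S : Finset ℕ) (r : ℝ), 0 < r →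
      ∏ i ∈ S, ‖(μ i : ℂ) + r * (1 + Complex.I)‖ ^ 2 / ‖(μ i : ℂ) - r * (1 + Complex.I)‖ ^ 2
        ≤ C * Real.exp (δ * r) := by
  obtain ⟨T, hT⟩ := summable_iff_vanishing_norm.1 hsum (δ / 8) (by positivity)
  refine ⟨6 ^ T.card, by positivity, fun S r hr => ?_⟩
  have hle := fun i => norm_ray_add_sq_div_le (hμ i) hr
  have h1 : ∏ i ∈ S ∩ T, ‖(μ i : ℂ) + r * (1 + Complex.I)‖ ^ 2
      / ‖(μ i : ℂ) - r * (1 + Complex.I)‖ ^ 2 ≤ 6 ^ T.card := by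
    refine (Finset.prod_le_prod (fun i _ => by positivity)
      fun i _ => (hle i).trans (min_le_left _ _)).trans ?_
    rw [Finset.prod_const]
    exact pow_le_pow_right₀ (by norm_num) (Finset.card_le_card Finset.inter_subset_right)
  have h2 : ∏ i ∈ S \ T, ‖(μ i : ℂ) + r * (1 + Complex.I)‖ ^ 2
      / ‖(μ i : ℂ) - r * (1 + Complex.I)‖ ^ 2 ≤ Real.exp (δ * r) := by
    refine (Finset.prod_le_prod (fun i _ => by positivity)
      fun i _ => (hle i).trans (min_le_right _ _)).trans ?_
    rw [← Real.exp_sum, ← Finset.mul_sum]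
    refine Real.exp_le_exp.2 ?_
    have := (le_abs_self _).trans (hT (S \ T) Finset.sdiff_disjoint).le
    nlinarith
  rw [← Finset.prod_inter_mul_prod_sdiff S T]
  exact mul_le_mul h1 h2 (Finset.prod_nonneg fun i _ => by positivity) (by positivity)

lemma norm_exp_ray_sub_le {s u v r : ℝ} (hr : 0 ≤ r) (hu : s ≤ u) (hv : s ≤ v) :
    ‖Complex.exp (-(u * (r * (1 + Complex.I)))) - Complex.exp (-(v * (r * (1 + Complex.I))))‖
      ≤ 2 * r * Real.exp (-(s * r)) * |u - v| := by
  have hd : ∀ x ∈ Ici s, HasDerivWithinAt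
      (fun x : ℝ => Complex.exp (-(x * (r * (1 + Complex.I)))))
      (Complex.exp (-(x * (r * (1 + Complex.I)))) * -(1 * (r * (1 + Complex.I)))) (Ici s) x := by
    intro x _
    exact (((Complex.ofRealCLM.hasDerivAt (x := x)).mul_const _).neg.cexp).hasDerivWithinAt
  have hb : ∀ x ∈ Ici s,
      ‖Complex.exp (-(x * (r * (1 + Complex.I)))) * -(1 * (r * (1 + Complex.I)))‖
        ≤ 2 * r * Real.exp (-(s * r)) := by
    intro x hx
    have h1 : ‖Complex.exp (-(x * (r * (1 + Complex.I))))‖ = Real.exp (-(x * r)) := by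
      rw [Complex.norm_exp]
      simp
    rw [norm_mul, h1, norm_neg, one_mul, norm_mul, Complex.norm_real, Real.norm_of_nonneg hr]
    have hx' : s ≤ x := hx
    calc _ ≤ Real.exp (-(s * r)) * (r * 2) := by
          gcongr
          exact norm_one_add_I_le
      _ = _ := by ring
  have := (convex_Ici s).norm_image_sub_le_of_norm_hasDerivWithin_le hd hb hv hu
  simpa [Real.norm_eq_abs] using this

/-- Exponential sums whose Gram form is at most `N ^ 2` are Lipschitz on `[s, ∞)`, with a constant that
depends only on `s` and the sequence of exponents: the decay `e^{-s r}` of Cauchy's kernel along the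
ray beats the growth of the Blaschke product. -/
lemma exists_lipschitz_expSum (μ : ℕ → ℝ) (hμ : ∀ i, 0 < μ i) (hsum : Summable fun i => 1 / μ i)
    {s : ℝ} (hs : 0 < s) :
    ∃ L : ℝ, 0 ≤ L ∧ ∀ (S : Finset ℕ) (c : ℕ → ℝ) (N : ℝ), 0 ≤ N → gramForm S μ c ≤ N ^ 2 →
      ∀ u v : ℝ, s ≤ u → s ≤ v →
        |∑ i ∈ S, c i * Real.exp (-(μ i * u)) - ∑ i ∈ S, c i * Real.exp (-(μ i * v))|
          ≤ L * N * |u - v| := by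
  obtain ⟨κ, hκ, hker⟩ := exists_exp_eq_integral
  obtain ⟨C, hC, hprod⟩ := exists_prod_ray_le μ hμ hsum (half_pos hs)
  set A := √(C / s) with hA
  refine ⟨|κ|⁻¹ * (4 * A * (2 / s)), by positivity, fun S c N hN hQ u v hu hv => ?_⟩
  set ψ : ℝ → ℝ → ℂ := fun x r =>
    (1 + Complex.I) * Complex.exp (-(x * (r * (1 + Complex.I))))
      * ∑ i ∈ S, (c i : ℂ) / (μ i - r * (1 + Complex.I)) with hψ
  have hψ_eq : ∀ x, ψ x = fun r : ℝ => ∑ i ∈ S, (c i : ℂ) * ((1 + Complex.I) *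
      Complex.exp (-(x * (r * (1 + Complex.I)))) / (μ i - r * (1 + Complex.I))) := by
    intro x
    funext r
    simp only [hψ]
    rw [Finset.mul_sum]
    exact Finset.sum_congr rfl fun i _ => by ring
  have hψ_int : ∀ x, 0 < x → IntegrableOn (ψ x) (Ioi 0) := by
    intro x hx
    rw [hψ_eq]
    exact integrable_finsetSum _ fun i _ => ((hker _ _ (hμ i) hx).1.const_mul _)
  have hψ_val : ∀ x, 0 < x →
      (∫ r in Ioi 0, ψ x r).im = κ * ∑ i ∈ S, c i * Real.exp (-(μ i * x)) := by
    intro x hx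
    rw [hψ_eq, integral_finsetSum _ fun i _ => ((hker _ _ (hμ i) hx).1.const_mul _),
      Complex.im_sum, Finset.mul_sum]
    refine Finset.sum_congr rfl fun i _ => ?_
    rw [integral_const_mul, Complex.im_ofReal_mul, (hker _ _ (hμ i) hx).2]
    ring
  have htrans : ∀ r : ℝ, 0 < r →
      r * ‖∑ i ∈ S, (c i : ℂ) / (μ i - r * (1 + Complex.I))‖ ≤ N * A * Real.exp (s / 2 * r) := by
    intro r hr
    have h := norm_sq_cauchy_transform_le S μ hμ (w := r * (1 + Complex.I))
      (by simpa using hr.ne') (by simpa using hr) c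
    have hre : ((r : ℂ) * (1 + Complex.I)).re = r := by simp
    rw [hre] at h
    refine le_of_sq_le_sq ?_ (by positivity)
    have hp := hprod S r hr
    rw [mul_pow, mul_pow, mul_pow, hA, Real.sq_sqrt (by positivity), ← Real.exp_nat_mul]
    set P := ∏ i ∈ S, ‖(μ i : ℂ) + r * (1 + Complex.I)‖ ^ 2 / ‖(μ i : ℂ) - r * (1 + Complex.I)‖ ^ 2
    -- absorbs the factor `r` left over from `r ^ 2 / (2 * r)`
    have hexp : s / 2 * r ≤ Real.exp (s / 2 * r) := by
      linarith [Real.add_one_le_exp (s / 2 * r)]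
    have hP0 : 0 ≤ P := Finset.prod_nonneg fun i _ => by positivity
    calc _ ≤ r ^ 2 * (gramForm S μ c * ((P - 1) / (2 * r))) := by gcongr
      _ ≤ r ^ 2 * (N ^ 2 * (C * Real.exp (s / 2 * r) / (2 * r))) := by
        have hP1 : (P - 1) / (2 * r) ≤ C * Real.exp (s / 2 * r) / (2 * r) := by
          gcongr
          linarith
        have hg : 0 ≤ gramForm S μ c := gramForm_nonneg S μ c hμ
        gcongr r ^ 2 * ?_
        calc _ ≤ gramForm S μ c * (C * Real.exp (s / 2 * r) / (2 * r)) := by gcongr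
          _ ≤ _ := by gcongr
      _ = N ^ 2 * (C / s) * (Real.exp (s / 2 * r) * (s / 2 * r)) := by field_simp
      _ ≤ N ^ 2 * (C / s) * (Real.exp (s / 2 * r) * Real.exp (s / 2 * r)) := by gcongr
      _ = _ := by
        rw [← Real.exp_add]
        congr 2
        push_cast
        ring
  have hdiff : ∀ r : ℝ, 0 < r → ‖ψ u r - ψ v r‖
      ≤ 4 * A * N * |u - v| * Real.exp (0 - s / 2 * r) := by
    intro r hr
    have : ψ u r - ψ v r = (1 + Complex.I) * (Complex.exp (-(u * (r * (1 + Complex.I))))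
        - Complex.exp (-(v * (r * (1 + Complex.I)))))
        * ∑ i ∈ S, (c i : ℂ) / (μ i - r * (1 + Complex.I)) := by
      simp only [hψ]
      ring
    rw [this, norm_mul, norm_mul]
    calc _ ≤ 2 * (2 * r * Real.exp (-(s * r)) * |u - v|)
          * ‖∑ i ∈ S, (c i : ℂ) / (μ i - r * (1 + Complex.I))‖ := by
          gcongr
          · exact norm_one_add_I_le
          · exact norm_exp_ray_sub_le hr.le hu hv
      _ = 4 * Real.exp (-(s * r)) * |u - v|
          * (r * ‖∑ i ∈ S, (c i : ℂ) / (μ i - r * (1 + Complex.I))‖) := by ring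
      _ ≤ 4 * Real.exp (-(s * r)) * |u - v| * (N * A * Real.exp (s / 2 * r)) :=
          mul_le_mul_of_nonneg_left (htrans r hr) (by positivity)
      _ = 4 * A * N * |u - v| * (Real.exp (-(s * r)) * Real.exp (s / 2 * r)) := by ring
      _ = _ := by
          rw [← Real.exp_add]
          congr 2
          ring
  have hu0 : 0 < u := hs.trans_le hu
  have hv0 : 0 < v := hs.trans_le hv
  have hmain : ‖(∫ r in Ioi 0, ψ u r) - ∫ r in Ioi 0, ψ v r‖ ≤ 4 * A * N * |u - v| * (2 / s) := by
    rw [← integral_sub (hψ_int u hu0) (hψ_int v hv0)]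
    refine (norm_integral_le_of_norm_le ((integrableOn_exp_sub_mul (half_pos hs) 0).const_mul _)
      ((ae_restrict_iff' measurableSet_Ioi).2 (ae_of_all _ fun r hr => hdiff r hr))).trans ?_
    rw [integral_const_mul]
    refine le_of_eq ?_
    congr 1
    have := integral_exp_mul_Ioi (show -(s / 2) < 0 by linarith) 0
    simp only [neg_mul, mul_zero, Real.exp_zero] at this
    simp only [zero_sub]
    rw [this, neg_div_neg_eq]
    field_simp
  have him : |κ| * |∑ i ∈ S, c i * Real.exp (-(μ i * u)) - ∑ i ∈ S, c i * Real.exp (-(μ i * v))|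
      ≤ 4 * A * N * |u - v| * (2 / s) := by
    rw [← abs_mul, mul_sub, ← hψ_val u hu0, ← hψ_val v hv0, ← Complex.sub_im]
    exact (Complex.abs_im_le_norm _).trans hmain
  have hκ' : 0 < |κ| := abs_pos.2 hκ
  calc _ = |κ|⁻¹ * (|κ| * |∑ i ∈ S, c i * Real.exp (-(μ i * u))
        - ∑ i ∈ S, c i * Real.exp (-(μ i * v))|) := by
        rw [← mul_assoc, inv_mul_cancel₀ hκ'.ne', one_mul]
    _ ≤ |κ|⁻¹ * (4 * A * N * |u - v| * (2 / s)) := by gcongr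
    _ = _ := by ring

/-- The unit ball of a Müntz space is equicontinuous on compact subsets of `(0, 1)`. The factor `√t`
comes from the shift of the exponents by `1/2`. -/
lemma exists_lipschitz_muntzSpace {Λ : ℕ → ℝ≥0} (hΛ : IsMuntzSequence Λ) {s : ℝ} (hs : 0 < s) :
    ∃ L : ℝ, ∀ y ∈ muntzSpace Λ, ∀ t t' : unitInterval, 0 < (t : ℝ) → 0 < (t' : ℝ) →
      s ≤ -Real.log t → s ≤ -Real.log t' →
        |√t * y t - √t' * y t'| ≤ L * ‖y‖ * |Real.log t - Real.log t'| := by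
  have hμ : ∀ i, 0 < (Λ i : ℝ) + 1 / 2 := fun i => by positivity
  have hsum : Summable fun i => 1 / ((Λ i : ℝ) + 1 / 2) := by
    rw [← summable_nat_add_iff 1]
    refine hΛ.summable.of_nonneg_of_le (fun i => by positivity) fun i => ?_
    have : (0 : ℝ) < Λ (i + 1) := by
      exact_mod_cast hΛ.zero ▸ hΛ.strictMono (Nat.succ_pos i)
    gcongr
    linarith
  obtain ⟨L, hL, h⟩ := exists_lipschitz_expSum _ hμ hsum hs
  refine ⟨L, fun y hy t t' ht ht' hst hst' => ?_⟩
  have hclosed : IsClosed {y : C(unitInterval, ℝ) |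
      |√t * y t - √t' * y t'| ≤ L * ‖y‖ * |Real.log t - Real.log t'|} :=
    isClosed_le (by fun_prop) (by fun_prop)
  refine closure_minimal (fun p hp => ?_) hclosed hy
  obtain ⟨c, rfl⟩ := (Finsupp.mem_span_range_iff_exists_finsupp).1 hp
  set p := ∑ i ∈ c.support, c i • powFun (Λ i) with hp_def
  have hval : ∀ t : unitInterval, 0 < (t : ℝ) →
      √t * p t = ∑ i ∈ c.support, c i * Real.exp (-(((Λ i : ℝ) + 1 / 2) * -Real.log t)) := by
    intro t ht
    have : p t = ∑ i ∈ c.support, c i * (t : ℝ) ^ (Λ i : ℝ) := by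
      simp [hp_def, ContinuousMap.sum_apply, powFun]
    rw [this, Finset.mul_sum]
    refine Finset.sum_congr rfl fun i _ => ?_
    rw [Real.sqrt_eq_rpow, mul_left_comm, ← Real.rpow_add ht, Real.rpow_def_of_pos ht]
    congr 2
    ring
  have := h c.support c ‖p‖ (norm_nonneg _) (gramForm_le_sq_norm _ _ _) _ _ hst hst'
  rw [← hval t ht, ← hval t' ht'] at this
  rw [neg_sub_neg, abs_sub_comm (Real.log _)] at this
  exact this

/-! ### Failure of local octahedrality -/

/-- For `0 < a < b` the function `t ^ a - t ^ b` is nonnegative and has a unique maximum, in the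
interior of `[0, 1]`: it is `v - v ^ (b / a)` with `v = t ^ a`. -/
lemma exists_peak {a b : ℝ≥0} (ha : 0 < a) (hab : a < b) :
    ∃ t₀ : unitInterval, 0 < (t₀ : ℝ) ∧ (t₀ : ℝ) < 1 ∧ 0 < (powFun a - powFun b) t₀ ∧
      (∀ t, 0 ≤ (powFun a - powFun b) t) ∧
      ∀ t, t ≠ t₀ → (powFun a - powFun b) t < (powFun a - powFun b) t₀ := by
  have hv : ∀ t : unitInterval, (powFun a - powFun b) t
      = (t : ℝ) ^ (a : ℝ) - ((t : ℝ) ^ (a : ℝ)) ^ ((b : ℝ) / a) := by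
    intro t
    rw [← Real.rpow_mul t.2.1, mul_div_cancel₀ _ (by exact_mod_cast ha.ne')]
    rfl
  have hq : 1 < (b : ℝ) / a := by
    rw [one_lt_div (by exact_mod_cast ha)]
    exact_mod_cast hab
  have hmem : ∀ t : unitInterval, (t : ℝ) ^ (a : ℝ) ∈ Icc (0 : ℝ) 1 := fun t =>
    ⟨Real.rpow_nonneg t.2.1 _, Real.rpow_le_one t.2.1 t.2.2 a.coe_nonneg⟩
  have hconc : StrictConcaveOn ℝ (Icc (0 : ℝ) 1) fun v => v - v ^ ((b : ℝ) / a) := by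
    have := (concaveOn_id (convex_Icc (0 : ℝ) 1)).sub_strictConvexOn
      ((strictConvexOn_rpow hq).subset Icc_subset_Ici_self (convex_Icc 0 1))
    exact this
  obtain ⟨t₀, -, ht₀⟩ := isCompact_univ.exists_isMaxOn univ_nonempty
    (powFun a - powFun b).continuous.continuousOn
  have hmax : ∀ t, (powFun a - powFun b) t ≤ (powFun a - powFun b) t₀ := fun t => ht₀ (mem_univ t)
  have hle : ∀ t, 0 ≤ (powFun a - powFun b) t := by
    intro t
    rw [hv, sub_nonneg]
    exact Real.rpow_le_self_of_le_one (hmem t).1 (hmem t).2 hq.le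
  have hsurj : ∀ v ∈ Icc (0 : ℝ) 1, ∃ t : unitInterval, (t : ℝ) ^ (a : ℝ) = v := by
    intro v hv
    refine ⟨⟨v ^ (a : ℝ)⁻¹, Real.rpow_nonneg hv.1 _,
      Real.rpow_le_one hv.1 hv.2 (by positivity)⟩, ?_⟩
    exact Real.rpow_inv_rpow hv.1 (by exact_mod_cast ha.ne')
  have hpos : 0 < (powFun a - powFun b) t₀ := by
    obtain ⟨t, ht⟩ := hsurj (1 / 2) (by norm_num)
    refine lt_of_lt_of_le ?_ (hmax t)
    rw [hv, ht, sub_pos]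
    exact Real.rpow_lt_self_of_lt_one (by norm_num) (by norm_num) hq
  have hmaxOn : ∀ t, (powFun a - powFun b) t = (powFun a - powFun b) t₀ →
      IsMaxOn (fun v : ℝ => v - v ^ ((b : ℝ) / a)) (Icc 0 1) ((t : ℝ) ^ (a : ℝ)) := by
    intro t ht v hv'
    obtain ⟨t', rfl⟩ := hsurj v hv'
    have := hmax t'
    rw [← ht, hv, hv] at this
    exact this
  have ha0 : (a : ℝ) ≠ 0 := by exact_mod_cast ha.ne'
  refine ⟨t₀, ?_, ?_, hpos, hle, fun t ht => lt_of_le_of_ne (hmax t) fun he => ht ?_⟩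
  · refine lt_of_le_of_ne t₀.2.1 fun h => hpos.ne' ?_
    rw [hv, ← h, Real.zero_rpow ha0, Real.zero_rpow (by linarith)]
    simp
  · refine lt_of_le_of_ne t₀.2.2 fun h => hpos.ne' ?_
    rw [hv, h]
    simp
  · have := hconc.eq_of_isMaxOn (hmaxOn t he) (hmaxOn t₀ rfl) (hmem t) (hmem t₀)
    exact Subtype.ext ((Real.rpow_left_inj t.2.1 t₀.2.1 ha0).1 this)

lemma not_locallyOctahedral_muntzSpace {Λ : ℕ → ℝ≥0} (hΛ : IsMuntzSequence Λ) :
    ¬ LocallyOctahedral (muntzSpace Λ) := by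
  have h1 : 0 < Λ 1 := hΛ.zero ▸ hΛ.strictMono one_pos
  obtain ⟨t₀, ht0, ht1, hpos, hnonneg, hlt⟩ :=
    exists_peak h1 (hΛ.strictMono (show 1 < 2 by norm_num))
  set g := powFun (Λ 1) - powFun (Λ 2) with hg
  have hgM : g ∈ muntzSpace Λ :=
    Submodule.le_topologicalClosure _ (Submodule.sub_mem _
      (Submodule.subset_span ⟨1, rfl⟩) (Submodule.subset_span ⟨2, rfl⟩))
  set m := g t₀ with hm
  set x := m⁻¹ • g with hx
  have hxt : ∀ t, x t = m⁻¹ * g t := fun t => rfl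
  have hxt₀ : x t₀ = 1 := by rw [hxt, ← hm, inv_mul_cancel₀ hpos.ne']
  have hx0 : ∀ t, 0 ≤ x t := fun t => mul_nonneg (inv_nonneg.2 hpos.le) (hnonneg t)
  have hxlt : ∀ t, t ≠ t₀ → x t < 1 := by
    intro t ht
    rw [hxt, inv_mul_lt_iff₀ hpos, mul_one]
    exact hlt t ht
  have hx1 : ∀ t, x t ≤ 1 := by
    intro t
    rcases eq_or_ne t t₀ with rfl | h
    · exact hxt₀.le
    · exact (hxlt t h).le
  have hnorm : ‖x‖ = 1 := by
    refine le_antisymm ((ContinuousMap.norm_le _ zero_le_one).2 fun t => ?_) ?_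
    · rw [Real.norm_of_nonneg (hx0 t)]
      exact hx1 t
    · have := x.norm_coe_le_norm t₀
      rwa [hxt₀, norm_one] at this
  have hs : 0 < -Real.log t₀ / 2 := by
    have := Real.log_neg ht0 ht1
    linarith
  obtain ⟨L, hL⟩ := exists_lipschitz_muntzSpace hΛ hs
  -- a neighbourhood of the peak on which the unit ball oscillates little
  obtain ⟨U, hU, ht₀U, hUprop⟩ : ∃ U : Set unitInterval, IsOpen U ∧ t₀ ∈ U ∧ ∀ t ∈ U,
      0 < (t : ℝ) ∧ (-Real.log t₀ / 2 ≤ -Real.log t) ∧ √t₀ / 2 < √t ∧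
        |L| * |Real.log t - Real.log t₀| < √t₀ / 8 := by
    have hlog : ContinuousAt (fun t : unitInterval => Real.log t) t₀ :=
      (continuous_subtype_val.continuousAt).log ht0.ne'
    have hsq : 0 < √(t₀ : ℝ) := Real.sqrt_pos.2 ht0
    have e1 : ∀ᶠ t : unitInterval in nhds t₀, 0 < (t : ℝ) :=
      continuous_subtype_val.continuousAt.eventually (lt_mem_nhds ht0)
    have e2 : ∀ᶠ t : unitInterval in nhds t₀, -Real.log t₀ / 2 < -Real.log t :=
      hlog.neg.eventually (lt_mem_nhds (by simp only [Pi.neg_apply]; linarith))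
    have e3 : ∀ᶠ t : unitInterval in nhds t₀, √t₀ / 2 < √t :=
      (Real.continuous_sqrt.comp continuous_subtype_val).continuousAt.eventually
        (lt_mem_nhds (by simp only [Function.comp]; linarith))
    have e4 : ∀ᶠ t : unitInterval in nhds t₀,
        |L| * |Real.log t - Real.log t₀| < √t₀ / 8 := by
      have hc : ContinuousAt (fun t : unitInterval => |L| * |Real.log t - Real.log t₀|) t₀ :=
        ((hlog.sub continuousAt_const).abs).const_mul _
      refine hc.eventually (gt_mem_nhds ?_)
      simp only [sub_self, abs_zero, mul_zero]
      positivity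
    obtain ⟨U, hU1, hU2, hU3⟩ := eventually_nhds_iff.1 (e1.and (e2.and (e3.and e4)))
    exact ⟨U, hU2, hU3, fun t ht =>
      ⟨(hU1 t ht).1, (hU1 t ht).2.1.le, (hU1 t ht).2.2.1, (hU1 t ht).2.2.2⟩⟩
  -- away from this neighbourhood, `x` stays below `1 - ε`
  obtain ⟨ε, hε0, hε1, hεU⟩ : ∃ ε : ℝ, 0 < ε ∧ ε ≤ 1 / 2 ∧ ∀ t, 1 - ε < x t → t ∈ U := by
    rcases (Uᶜ).eq_empty_or_nonempty with he | hne
    · exact ⟨1 / 2, by norm_num, le_rfl, fun t _ => by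
        rw [compl_empty_iff] at he; rw [he]; trivial⟩
    · obtain ⟨t₁, ht₁, hmax⟩ := hU.isClosed_compl.isCompact.exists_isMaxOn hne
        x.continuous.continuousOn
      have h : x t₁ < 1 := hxlt t₁ fun h => ht₁ (h ▸ ht₀U)
      refine ⟨min (1 / 2) (1 - x t₁), lt_min (by norm_num) (by linarith), min_le_left _ _,
        fun t ht => ?_⟩
      by_contra hcon
      have h2 : x t ≤ x t₁ := hmax hcon
      have := min_le_right (1 / 2) (1 - x t₁)
      linarith
  -- a perturbation of norm close to two comes from a point of this neighbourhood
  have hnear : ∀ y : C(unitInterval, ℝ), ‖y‖ = 1 → ‖x + y‖ > 2 - ε → ∃ t ∈ U, 1 / 2 < y t := by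
    intro y hy hxy
    obtain ⟨t, ht⟩ : ∃ t, 2 - ε < ‖(x + y) t‖ := by
      by_contra hcon
      push Not at hcon
      exact absurd ((ContinuousMap.norm_le _ (by linarith)).2 hcon) (not_le.2 hxy)
    have hyt := abs_le.1 ((y.norm_coe_le_norm t).trans hy.le)
    have hxt0 := hx0 t
    have hxt1 := hx1 t
    rw [ContinuousMap.add_apply, Real.norm_eq_abs, lt_abs] at ht
    rcases ht with ht | ht
    · exact ⟨t, hεU t (by linarith), by linarith⟩
    · linarith
  intro hLO
  obtain ⟨y, hy, hp, hn⟩ := hLO ⟨x, Submodule.smul_mem _ _ hgM⟩ hnorm ε hε0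
  obtain ⟨y, hyM⟩ := y
  have hy' : ‖y‖ = 1 := hy
  obtain ⟨t, htU, ht⟩ := hnear y hy' hp
  obtain ⟨t', htU', ht'⟩ := hnear (-y) (by rwa [norm_neg]) (by rw [← sub_eq_add_neg]; exact hn)
  rw [ContinuousMap.neg_apply] at ht'
  obtain ⟨p1, p2, p3, p4⟩ := hUprop t htU
  obtain ⟨q1, q2, q3, q4⟩ := hUprop t' htU'
  have hlip := hL y hyM t t' p1 q1 p2 q2
  rw [hy', mul_one] at hlip
  have htri : |Real.log t - Real.log t'| ≤ |Real.log t - Real.log t₀|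
      + |Real.log t' - Real.log t₀| := by
    rw [abs_sub_comm (Real.log t')]
    exact abs_sub_le _ _ _
  have hup : √t * y t - √t' * y t' ≤ √t₀ / 4 := by
    calc _ ≤ L * |Real.log t - Real.log t'| := (le_abs_self _).trans hlip
      _ ≤ |L| * (|Real.log t - Real.log t₀| + |Real.log t' - Real.log t₀|) := by
        gcongr
        exact le_abs_self L
      _ ≤ √t₀ / 4 := by linarith
  have hsq : 0 < √(t₀ : ℝ) := Real.sqrt_pos.2 ht0
  nlinarith

lemma Octahedral.locallyOctahedral {X : Type*} [NormedAddCommGroup X] (h : Octahedral X) :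
    LocallyOctahedral X := by
  intro x hx ε hε
  obtain ⟨y, hy, hxy⟩ := h 1 le_rfl (fun _ => x) (fun _ => hx) ε hε
  exact ⟨y, hy, hxy 0⟩

theorem mainTheorem2 (Λ : ℕ → ℝ≥0) (hΛ : IsMuntzSequence Λ) :
    ¬ LocallyOctahedral (muntzSpace Λ) ∧ ¬ Octahedral (muntzSpace Λ) :=
  ⟨not_locallyOctahedral_muntzSpace hΛ,
    fun h => not_locallyOctahedral_muntzSpace hΛ h.locallyOctahedral⟩
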